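/- Let $\mathbb X$ and $\mathbb Y$ be Euclidean spaces (finite-dimensional real Hilbert spaces), let $\varphi\colon\mathbb X\to\mathbb R$ be locally Lipschitz continuous, let $\Phi\colon\mathbb X\rightrightarrows\mathbb Y$ be a set-valued mapping whose graph $\operatorname{gph}\Phi=\{(x,y)\mid y\in\Phi(x)\}$ is closed, and let $\bar y\in\mathbb Y$. Consider the problem $$\text{(P)}\qquad \min\{\varphi(x)\mid \bar y\in\Phi(x)\},\qquad \mathcal F:=\{x\in\mathbb X\mid \bar y\in\Phi(x)\}.$$ Notation. In what follows, $t_k\searrow0$ means $t_k>0$ and $t_k\to0$. For a closed set $Q$ in a Euclidean space and $x\in Q$, let - $\mathcal T_Q(x)$ be the set of all $d$ for which there are $d_k\to d$ and $t_k\searrow 0$ with $x+t_kd_k\in Q$ for all $k$; - $\widehat{\mathcal N}_Q(x):=\{\eta\mid \langle\eta,x'-x\rangle\le o(\|x'-x\|)\ \forall x'\in Q\}$, and $\widehat{\mathcal N}_Q(x'):=\varnothing$ for $x'\notin Q$; - $\mathcal N_Q(x)$ be the set of all limits of sequences $\eta_k\in\widehat{\mathcal N}_Q(x_k)$ with $x_k\to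 x$; - $\mathcal N_Q(x;d)$ be the set of all limits of sequences $\eta_k\in\widehat{\mathcal N}_Q(x+t_kd_k)$ with $d_k\to d$ and $t_k\searrow0$. Put $\partial\varphi(\bar x):=\{\eta\mid(\eta,-1)\in\mathcal N_{\operatorname{epi}\varphi}(\bar x,\varphi(\bar x))\}$, where $\operatorname{epi}\varphi=\{(x,\alpha)\in\mathbb X\times\mathbb R\mid\varphi(x)\le\alpha\}$, and, for $(\bar x,\bar y)\in\operatorname{gph}\Phi$, $$D\Phi(\bar x,\bar y)(u):=\{v\mid (u,v)\in\mathcal T_{\operatorname{gph}\Phi}(\bar x,\bar y)\},$$ $$D^*\Phi(\bar x,\bar y)(\lambda):=\{x^*\mid(x^*,-\lambda)\in\mathcal N_{\operatorname{gph}\Phi}(\bar x,\bar y)\},$$ $$D^*\Phi((\bar x,\bar y);(u,v))(\lambda):=\{x^*\mid(x^*,-\lambda)\in\mathcal N_{\operatorname{gph}\Phi}((\bar x,\bar y);(u,v))\}.$$ The kernel of a set-valued mapping $\Psi$ is $\ker\Psi:=\{a\mid 0\in\Psi(a)\}$. A point $\bar x\in\mathcal F$ is *M-stationary* if there is $\lambda\in\mathbb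 Y$ with $0\in\partial\varphi(\bar x)+D^*\Phi(\bar x,\bar y)(\lambda)$. A direction $u\in\mathbb X$ with $\|u\|=1$ is *critical* for (P) at $\bar x\in\mathcal F$ if there are sequences $u_k\to u$ in $\mathbb X$, $v_k\to0$ in $\mathbb Y$ and $t_k\searrow0$ such that $(\bar x+t_ku_k,\bar y+t_kv_k)\in\operatorname{gph}\Phi$ for all $k$ and $\limsup_{k\to\infty}\,(\varphi(\bar x+t_ku_k)-\varphi(\bar x))/t_k\le0$. The *First-Order Sufficient Condition for Metric Subregularity* (FOSCMS) holds at $(\bar x,\bar y)$ if $\ker D^*\Phi((\bar x,\bar y);(u,0))=\{0\}$ for every $u\in\ker D\Phi(\bar x,\bar y)$ with $\|u\|=1$. **Statement.** Let $\bar x\in\mathcal F$ be a local minimizer of (P). Then $\bar x$ is M-stationary, or there exist a critical direction $u$ for (P) at $\bar x$ and $\lambda\in\mathbb Y\setminus\{0\}$ such that $0\in D^*\Phi((\bar x,\bar y);(u,0))(\lambda)$. In particular, if FOSCMS holds at $(\bar x,\bar y)$, then $\bar x$ is M-stationary. -/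

import Mathlib

open Filter Topology
open scoped Pointwise

noncomputable section

namespace VarAnal

section Cones

variable {E : Type*} [NormedAddCommGroup E] [InnerProductSpace ℝ E]

/-- The Bouligand tangent cone to `Q` at `x` (empty if `x ∉ Q`). Here `t k ↘ 0` means that the
`t k` are positive and converge to zero. -/
def tangentCone (Q : Set E) (x : E) : Set E :=
  {d | x ∈ Q ∧ ∃ (dk : ℕ → E) (t : ℕ → ℝ),
    Tendsto dk atTop (𝓝 d) ∧ (∀ k, 0 < t k) ∧ Tendsto t atTop (𝓝 0) ∧
    ∀ k, x + t k • dk k ∈ Q}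

/-- The regular (Fréchet) normal cone to `Q` at `x` (empty if `x ∉ Q`):
`⟪η, x' - x⟫ ≤ o(‖x' - x‖)` for `x' ∈ Q`. -/
def regularNormalCone (Q : Set E) (x : E) : Set E :=
  {η | x ∈ Q ∧ ∀ ε : ℝ, 0 < ε → ∀ᶠ x' in 𝓝[Q] x, inner ℝ η (x' - x) ≤ ε * ‖x' - x‖}

/-- The limiting (Mordukhovich) normal cone to `Q` at `x` (empty if `x ∉ Q`). -/
def limitingNormalCone (Q : Set E) (x : E) : Set E :=
  {η | x ∈ Q ∧ ∃ (xk ηk : ℕ → E),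
    Tendsto xk atTop (𝓝 x) ∧ Tendsto ηk atTop (𝓝 η) ∧
    ∀ k, ηk k ∈ regularNormalCone Q (xk k)}

/-- The limiting normal cone to `Q` at `x` in direction `d`. -/
def dirLimitingNormalCone (Q : Set E) (x d : E) : Set E :=
  {η | x ∈ Q ∧ ∃ (dk : ℕ → E) (t : ℕ → ℝ) (ηk : ℕ → E),
    Tendsto dk atTop (𝓝 d) ∧ (∀ k, 0 < t k) ∧ Tendsto t atTop (𝓝 0) ∧
    Tendsto ηk atTop (𝓝 η) ∧
    ∀ k, ηk k ∈ regularNormalCone Q (x + t k • dk k)}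

end Cones

variable {X Y : Type*}
  [NormedAddCommGroup X] [InnerProductSpace ℝ X]
  [NormedAddCommGroup Y] [InnerProductSpace ℝ Y]

/-- The epigraph of `φ`, in the product `X × ℝ` with its Euclidean structure. -/
def epigraph (φ : X → ℝ) : Set (WithLp 2 (X × ℝ)) :=
  {p | φ p.fst ≤ p.snd}

/-- The limiting (Mordukhovich) subdifferential of `φ` at `x`. -/
def limitingSubdifferential (φ : X → ℝ) (x : X) : Set X :=
  {η | WithLp.toLp 2 (η, (-1 : ℝ)) ∈ limitingNormalCone (epigraph φ) (WithLp.toLp 2 (x, φ x))}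

/-- The graph of a set-valued mapping, in the product `X × Y` with its Euclidean structure. -/
def graph (Φ : X → Set Y) : Set (WithLp 2 (X × Y)) :=
  {p | p.snd ∈ Φ p.fst}

/-- The graphical derivative `DΦ(x, y)`, as a set-valued mapping from `X` to `Y`. -/
def graphicalDerivative (Φ : X → Set Y) (x : X) (y : Y) (u : X) : Set Y :=
  {v | WithLp.toLp 2 (u, v) ∈ tangentCone (graph Φ) (WithLp.toLp 2 (x, y))}

/-- The limiting coderivative `D*Φ(x, y)`, as a set-valued mapping from `Y` to `X`. -/
def limitingCoderivative (Φ : X → Set Y) (x : X) (y : Y) (yst : Y) : Set X :=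
  {xst | WithLp.toLp 2 (xst, -yst) ∈ limitingNormalCone (graph Φ) (WithLp.toLp 2 (x, y))}

/-- The directional limiting coderivative `D*Φ((x, y); (u, v))`, as a set-valued mapping from
`Y` to `X`. -/
def dirLimitingCoderivative (Φ : X → Set Y) (x : X) (y : Y) (u : X) (v : Y) (yst : Y) : Set X :=
  {xst | WithLp.toLp 2 (xst, -yst) ∈
    dirLimitingNormalCone (graph Φ) (WithLp.toLp 2 (x, y)) (WithLp.toLp 2 (u, v))}

/-- The kernel of a set-valued mapping. -/
def setKer {A B : Type*} [Zero B] (Ψ : A → Set B) : Set A :=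
  {a | (0 : B) ∈ Ψ a}

/-- The feasible set of the problem `min {φ(x) | ybar ∈ Φ(x)}`. -/
def feasibleSet (Φ : X → Set Y) (ybar : Y) : Set X :=
  {x | ybar ∈ Φ x}

/-- M-stationarity of `xbar` for the problem `min {φ(x) | ybar ∈ Φ(x)}`. -/
def IsMStationary (φ : X → ℝ) (Φ : X → Set Y) (ybar : Y) (xbar : X) : Prop :=
  xbar ∈ feasibleSet Φ ybar ∧
    ∃ lam : Y, (0 : X) ∈ limitingSubdifferential φ xbar + limitingCoderivative Φ xbar ybar lam

/-- `u` is a critical direction at `xbar` for the problem `min {φ(x) | ybar ∈ Φ(x)}`. The upper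
limit is taken in the extended reals. -/
def IsCriticalDirection (φ : X → ℝ) (Φ : X → Set Y) (ybar : Y) (xbar u : X) : Prop :=
  u ∈ Metric.sphere (0 : X) 1 ∧
    ∃ (uk : ℕ → X) (vk : ℕ → Y) (t : ℕ → ℝ),
      Tendsto uk atTop (𝓝 u) ∧ Tendsto vk atTop (𝓝 0) ∧
      (∀ k, 0 < t k) ∧ Tendsto t atTop (𝓝 0) ∧
      (∀ k, WithLp.toLp 2 (xbar + t k • uk k, ybar + t k • vk k) ∈ graph Φ) ∧
      limsup (fun k => (((φ (xbar + t k • uk k) - φ xbar) / t k : ℝ) : EReal)) atTop ≤ 0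

/-- The First-Order Sufficient Condition for Metric Subregularity of `Φ` at `(x, y)`. -/
def FOSCMS (Φ : X → Set Y) (x : X) (y : Y) : Prop :=
  ∀ u ∈ setKer (graphicalDerivative Φ x y) ∩ Metric.sphere (0 : X) 1,
    setKer (dirLimitingCoderivative Φ x y u 0) = {0}

end VarAnal

end

open Filter Topology

namespace VarAnal

/-! ### Regular normals from quadratic bounds. -/

section Cones

variable {E : Type*} [NormedAddCommGroup E] [InnerProductSpace ℝ E]

/-! Quadratic penalization, with a copy `z` of `x` inside `φ`. The decoupling makes a penalty
minimizer yield separate regular normals to `epi φ` and `gph Φ`, so no sum rule is needed; `η = c (x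
- z)` stays bounded by `2K`, with `K` a local Lipschitz constant.

The multipliers `λ = c (y - ybar)` decide the case. If they stay bounded along a subsequence, limits
of the normals give M-stationarity. Otherwise `‖λ‖ → ∞`, and dividing the graph normals by `‖λ‖`
leaves `(0, -lam)` with `‖lam‖ = 1`. The rates in `exists_approximately_stationary_sequence` make
`‖y - ybar‖` and `‖x - z‖` both `O(‖x - xbar‖ / ‖λ‖)`. The first puts the limit normal in a
direction `(u, 0)`; the second makes `u` critical, as `φ x - φ xbar ≤ K ‖x - z‖`. -/

theorem mem_regularNormalCone_of_quadratic_bound {Q : Set E} {p η : E} (hp : p ∈ Q) (C : ℝ)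
    (h : ∀ᶠ q in 𝓝[Q] p, inner ℝ η (q - p) ≤ C * ‖q - p‖ ^ 2) :
    η ∈ regularNormalCone Q p := by
  refine ⟨hp, fun ε hε => ?_⟩
  have hlim : Tendsto (fun q : E => C * ‖q - p‖) (𝓝[Q] p) (𝓝 0) := by
    have : Continuous fun q : E => C * ‖q - p‖ := by fun_prop
    simpa using (this.tendsto p).mono_left nhdsWithin_le_nhds
  filter_upwards [h, hlim.eventually_lt_const hε] with q hq hq'
  calc inner ℝ η (q - p) ≤ (C * ‖q - p‖) * ‖q - p‖ := by rw [mul_assoc, ← sq]; exact hq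
    _ ≤ ε * ‖q - p‖ := by gcongr

theorem smul_mem_regularNormalCone {Q : Set E} {p η : E} (h : η ∈ regularNormalCone Q p)
    {r : ℝ} (hr : 0 < r) : r • η ∈ regularNormalCone Q p := by
  refine ⟨h.1, fun ε hε => ?_⟩
  filter_upwards [h.2 (ε / r) (by positivity)] with q hq
  rw [real_inner_smul_left]
  calc r * inner ℝ η (q - p) ≤ r * (ε / r * ‖q - p‖) := by gcongr
    _ = ε * ‖q - p‖ := by field_simp

theorem norm_sub_sq_eq_add_inner (a b o : E) :
    ‖b - o‖ ^ 2 = ‖a - o‖ ^ 2 + 2 * inner ℝ (a - o) (b - a) + ‖b - a‖ ^ 2 := by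
  rw [← norm_add_sq_real]
  congr 2
  abel

end Cones

/-! ### Penalty minimizers and their optimality conditions. -/

variable {X Y : Type*} [NormedAddCommGroup X] [NormedAddCommGroup Y]

/-- The quadratic penalty function of the problem `min {φ(x) | ybar ∈ Φ(x)}`, in which the
argument of `φ` is decoupled from the argument of `Φ`. -/
noncomputable def penalty (φ : X → ℝ) (ybar : Y) (xbar : X) (c : ℝ) (x : X) (y : Y) (z : X) : ℝ :=
  φ z + c / 2 * ‖y - ybar‖ ^ 2 + 1 / 2 * ‖x - xbar‖ ^ 2 + c / 2 * ‖x - z‖ ^ 2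

/-- `(x, y, z)` minimizes the penalty function subject to `y ∈ Φ x` and to the localization to
balls around the reference point. -/
structure IsPenaltyMinimizer (φ : X → ℝ) (Φ : X → Set Y) (ybar : Y) (xbar : X) (ε c : ℝ)
    (x : X) (y : Y) (z : X) : Prop where
  mem : y ∈ Φ x
  left_mem : x ∈ Metric.closedBall xbar ε
  value_mem : y ∈ Metric.closedBall ybar 1
  right_mem : z ∈ Metric.closedBall xbar ε
  le : ∀ x' y' z', y' ∈ Φ x' → x' ∈ Metric.closedBall xbar ε → y' ∈ Metric.closedBall ybar 1 →
    z' ∈ Metric.closedBall xbar ε →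
    penalty φ ybar xbar c x y z ≤ penalty φ ybar xbar c x' y' z'

namespace IsPenaltyMinimizer

variable {φ : X → ℝ} {Φ : X → Set Y} {ybar : Y} {xbar : X} {ε c : ℝ} {x : X} {y : Y} {z : X}

/-- Compare with `(x, y, x)`: the coupling term costs at most the Lipschitz gap `φ x - φ z`. -/
theorem mul_norm_sub_le (h : IsPenaltyMinimizer φ Φ ybar xbar ε c x y z) {K : ℝ}
    (hK : ∀ a ∈ Metric.closedBall xbar ε, ∀ b ∈ Metric.closedBall xbar ε,
      φ a - φ b ≤ K * ‖a - b‖) (hK0 : 0 ≤ K) : c * ‖x - z‖ ≤ 2 * K := by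
  have h1 := h.le x y x h.mem h.left_mem h.value_mem h.left_mem
  have h2 := hK x h.left_mem z h.right_mem
  simp only [penalty, sub_self, norm_zero] at h1
  rcases (norm_nonneg (x - z)).eq_or_lt with h0 | h0
  · rw [← h0]; linarith
  · refine le_of_mul_le_mul_right ?_ h0
    nlinarith

theorem value_le (h : IsPenaltyMinimizer φ Φ ybar xbar ε c x y z) (hc : 0 ≤ c) (hε : 0 ≤ ε)
    (hfeas : ybar ∈ Φ xbar) :
    φ z + c / 2 * ‖y - ybar‖ ^ 2 + 1 / 2 * ‖x - xbar‖ ^ 2 ≤ φ xbar := by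
  have h1 := h.le xbar ybar xbar hfeas (by simp [hε]) (by simp) (by simp [hε])
  simp only [penalty, sub_self, norm_zero] at h1
  have : 0 ≤ c / 2 * ‖x - z‖ ^ 2 := by positivity
  linarith

variable [InnerProductSpace ℝ X]

/-- With `x` and `y` frozen, `z` locally minimizes `φ` plus a smooth quadratic; the negative
gradient of the latter is `c (x - z)`. -/
theorem mem_regularNormalCone_epigraph (h : IsPenaltyMinimizer φ Φ ybar xbar ε c x y z)
    (hc : 0 ≤ c) (hz : z ∈ Metric.ball xbar ε) :
    WithLp.toLp 2 (c • (x - z), (-1 : ℝ)) ∈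
      regularNormalCone (epigraph φ) (WithLp.toLp 2 (z, φ z)) := by
  refine mem_regularNormalCone_of_quadratic_bound (le_refl (φ z)) c ?_
  have hcont := WithLp.prod_continuous_ofLp 2 X ℝ
  have h1 : ∀ᶠ q : WithLp 2 (X × ℝ) in 𝓝 (WithLp.toLp 2 (z, φ z)),
      q.fst ∈ Metric.ball xbar ε :=
    (continuous_fst.comp hcont).continuousAt.eventually_mem (Metric.isOpen_ball.mem_nhds hz)
  filter_upwards [self_mem_nhdsWithin, h1.filter_mono nhdsWithin_le_nhds] with q hq hqz
  have hle := h.le x y q.fst h.mem h.left_mem h.value_mem (Metric.ball_subset_closedBall hqz)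
  have hq' : φ q.fst ≤ q.snd := hq
  have e1 := norm_sub_sq_eq_add_inner z q.fst x
  rw [WithLp.prod_norm_sq_eq_of_L2, WithLp.prod_inner_apply]
  simp only [penalty] at hle
  rw [norm_sub_rev x q.fst, norm_sub_rev x z, e1] at hle
  have e2 : inner ℝ (-1 : ℝ) (q.snd - φ z) = φ z - q.snd := by
    simp [inner]
  have e3 : inner ℝ (z - x) (q.fst - z) = - inner ℝ (x - z) (q.fst - z) := by
    rw [← inner_neg_left, neg_sub]
  rw [e3] at hle
  have p2 := mul_nonneg hc (sq_nonneg ‖q.fst - z‖)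
  have p3 := mul_nonneg hc (sq_nonneg ‖q.snd - φ z‖)
  simp only [WithLp.ofLp_sub, Prod.fst_sub, Prod.snd_sub,
    real_inner_smul_left, WithLp.sub_fst, WithLp.sub_snd] at hle ⊢
  simp only [WithLp.fst, WithLp.snd] at *
  rw [e2]
  linarith

variable [InnerProductSpace ℝ Y]

/-- With `z` frozen, the objective is a smooth quadratic on `gph Φ`, whose negative gradient is a
regular normal. -/
theorem mem_regularNormalCone_graph (h : IsPenaltyMinimizer φ Φ ybar xbar ε c x y z)
    (hc : 0 ≤ c) (hx : x ∈ Metric.ball xbar ε) (hy : y ∈ Metric.ball ybar 1) :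
    WithLp.toLp 2 (-(c • (x - z)) - (x - xbar), -(c • (y - ybar))) ∈
      regularNormalCone (graph Φ) (WithLp.toLp 2 (x, y)) := by
  refine mem_regularNormalCone_of_quadratic_bound h.mem (c + 1) ?_
  have hcont := WithLp.prod_continuous_ofLp 2 X Y
  have h1 : ∀ᶠ q : WithLp 2 (X × Y) in 𝓝 (WithLp.toLp 2 (x, y)), q.fst ∈ Metric.ball xbar ε :=
    (continuous_fst.comp hcont).continuousAt.eventually_mem (Metric.isOpen_ball.mem_nhds hx)
  have h2 : ∀ᶠ q : WithLp 2 (X × Y) in 𝓝 (WithLp.toLp 2 (x, y)), q.snd ∈ Metric.ball ybar 1 :=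
    (continuous_snd.comp hcont).continuousAt.eventually_mem (Metric.isOpen_ball.mem_nhds hy)
  filter_upwards [self_mem_nhdsWithin, h1.filter_mono nhdsWithin_le_nhds,
    h2.filter_mono nhdsWithin_le_nhds] with q hq hqx hqy
  have hle := h.le q.fst q.snd z hq (Metric.ball_subset_closedBall hqx)
    (Metric.ball_subset_closedBall hqy) h.right_mem
  have e1 := norm_sub_sq_eq_add_inner x q.fst xbar
  have e2 := norm_sub_sq_eq_add_inner x q.fst z
  have e3 := norm_sub_sq_eq_add_inner y q.snd ybar
  rw [WithLp.prod_norm_sq_eq_of_L2, WithLp.prod_inner_apply]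
  simp only [penalty] at hle
  rw [e1, e2, e3] at hle
  simp only [WithLp.ofLp_sub, Prod.fst_sub, Prod.snd_sub, inner_sub_left, inner_neg_left,
    real_inner_smul_left, WithLp.sub_fst, WithLp.sub_snd] at hle ⊢
  have p1 := sq_nonneg ‖q.fst - x‖
  have p2 := mul_nonneg hc (sq_nonneg ‖q.fst - x‖)
  have p3 := mul_nonneg hc (sq_nonneg ‖q.snd - y‖)
  have p4 := sq_nonneg ‖q.snd - y‖
  simp only [WithLp.fst, WithLp.snd] at *
  linarith

end IsPenaltyMinimizer

/-! ### Existence and convergence of penalty minimizers. -/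

variable [InnerProductSpace ℝ X] [InnerProductSpace ℝ Y]

theorem exists_isPenaltyMinimizer [FiniteDimensional ℝ X] [FiniteDimensional ℝ Y]
    {φ : X → ℝ} (hφ : Continuous φ) {Φ : X → Set Y} (hΦ : IsClosed (graph Φ))
    {ybar : Y} {xbar : X} (hfeas : ybar ∈ Φ xbar) {ε : ℝ} (hε : 0 ≤ ε) (c : ℝ) :
    ∃ x y z, IsPenaltyMinimizer φ Φ ybar xbar ε c x y z := by
  have := FiniteDimensional.proper_real X
  have := FiniteDimensional.proper_real Y
  let S : Set (X × Y × X) :=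
    (Metric.closedBall xbar ε ×ˢ Metric.closedBall ybar 1 ×ˢ Metric.closedBall xbar ε) ∩
      {p | WithLp.toLp 2 (p.1, p.2.1) ∈ graph Φ}
  have hS : IsCompact S := by
    refine ((isCompact_closedBall _ _).prod
      ((isCompact_closedBall _ _).prod (isCompact_closedBall _ _))).inter_right
      (hΦ.preimage (f := fun p : X × Y × X => WithLp.toLp 2 (p.1, p.2.1)) ?_)
    exact (WithLp.prod_continuous_toLp 2 X Y).comp (by fun_prop)
  have hne : S.Nonempty :=
    ⟨(xbar, ybar, xbar), by simp [hε], hfeas⟩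
  have hcont : Continuous fun p : X × Y × X => penalty φ ybar xbar c p.1 p.2.1 p.2.2 := by
    unfold penalty
    fun_prop
  obtain ⟨⟨x, y, z⟩, ⟨⟨hx, hy, hz⟩, hg⟩, hmin⟩ := hS.exists_isMinOn hne hcont.continuousOn
  exact ⟨x, y, z, hg, hx, hy, hz, fun x' y' z' hm hx' hy' hz' =>
    hmin (show (x', y', z') ∈ S from ⟨⟨hx', hy', hz'⟩, hm⟩)⟩

/-- Around a local minimizer, minimizers of the penalty function along a sequence of penalty
parameters tending to infinity can be chosen to converge to the reference point. -/
theorem exists_tendsto_isPenaltyMinimizer [FiniteDimensional ℝ X] [FiniteDimensional ℝ Y]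
    {φ : X → ℝ} (hφ : Continuous φ) {Φ : X → Set Y} (hΦ : IsClosed (graph Φ))
    {ybar : Y} {xbar : X} (hfeas : ybar ∈ Φ xbar) {ε K : ℝ} (hε : 0 ≤ ε) (hK0 : 0 ≤ K)
    (hK : ∀ a ∈ Metric.closedBall xbar ε, ∀ b ∈ Metric.closedBall xbar ε,
      φ a - φ b ≤ K * ‖a - b‖)
    (hmin : ∀ a ∈ Metric.closedBall xbar ε, ybar ∈ Φ a → φ xbar ≤ φ a) :
    ∃ (c : ℕ → ℝ) (x : ℕ → X) (y : ℕ → Y) (z : ℕ → X), (∀ j, 0 < c j) ∧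
      Tendsto x atTop (𝓝 xbar) ∧ Tendsto y atTop (𝓝 ybar) ∧ Tendsto z atTop (𝓝 xbar) ∧
      ∀ j, IsPenaltyMinimizer φ Φ ybar xbar ε (c j) (x j) (y j) (z j) := by
  have := FiniteDimensional.proper_real X
  have := FiniteDimensional.proper_real Y
  choose x y z h using fun k : ℕ =>
    exists_isPenaltyMinimizer hφ hΦ hfeas hε ((k : ℝ) + 1)
  have hpos : ∀ k : ℕ, (0 : ℝ) < (k : ℝ) + 1 := fun k => by positivity
  have hinv : ∀ C : ℝ, Tendsto (fun k : ℕ => C / ((k : ℝ) + 1)) atTop (𝓝 0) := fun C => by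
    simpa [div_eq_mul_inv] using tendsto_one_div_add_atTop_nhds_zero_nat.const_mul C
  have hxz : Tendsto (fun k => x k - z k) atTop (𝓝 0) := by
    refine squeeze_zero_norm (fun k => ?_) (hinv (2 * K))
    rw [le_div_iff₀ (hpos k), mul_comm]
    exact (h k).mul_norm_sub_le hK hK0
  have hy : Tendsto (fun k => y k - ybar) atTop (𝓝 0) := by
    have hsq : Tendsto (fun k => ‖y k - ybar‖ ^ 2) atTop (𝓝 0) := by
      refine squeeze_zero (fun k => by positivity) (fun k => ?_) (hinv (2 * (K * ε)))
      rw [le_div_iff₀ (hpos k)]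
      have h1 := (h k).value_le (hpos k).le hε hfeas
      have h2 := hK xbar (by simp [hε]) (z k) (h k).right_mem
      have h3 : K * ‖xbar - z k‖ ≤ K * ε := by
        gcongr
        simpa [dist_eq_norm, norm_sub_rev] using (h k).right_mem
      have := sq_nonneg ‖x k - xbar‖
      linarith
    have := hsq.sqrt
    simp only [Real.sqrt_sq (norm_nonneg _), Real.sqrt_zero] at this
    exact tendsto_zero_iff_norm_tendsto_zero.2 this
  replace hy : Tendsto y atTop (𝓝 ybar) := tendsto_sub_nhds_zero_iff.1 hy
  obtain ⟨a, ha, ψ, hψ, hxa⟩ :=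
    (isCompact_closedBall xbar ε).tendsto_subseq fun k => (h k).left_mem
  have hza : Tendsto (z ∘ ψ) atTop (𝓝 a) := by
    simpa [Function.comp_def] using hxa.sub (hxz.comp hψ.tendsto_atTop)
  have hya := hy.comp hψ.tendsto_atTop
  have hfa : ybar ∈ Φ a := by
    have : WithLp.toLp 2 (a, ybar) ∈ graph Φ :=
      hΦ.mem_of_tendsto (((WithLp.prod_continuous_toLp 2 X Y).tendsto (a, ybar)).comp
        (hxa.prodMk_nhds hya)) (Eventually.of_forall fun k => (h (ψ k)).mem)
    exact this
  -- The proximal term survives in the limit, so local minimality forces `a = xbar`.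
  have hle : φ a + 1 / 2 * ‖a - xbar‖ ^ 2 ≤ φ xbar := by
    refine le_of_tendsto (((hφ.tendsto a).comp hza).add
      (((hxa.sub_const xbar).norm.pow 2).const_mul (1 / 2))) (Eventually.of_forall fun k => ?_)
    have h1 := (h (ψ k)).value_le (hpos _).le hε hfeas
    have h2 : 0 ≤ ((ψ k : ℝ) + 1) / 2 * ‖y (ψ k) - ybar‖ ^ 2 := by positivity
    simp only [Function.comp_apply]
    linarith
  have haeq : a = xbar := by
    have h1 := hmin a ha hfa
    have h2 : ‖a - xbar‖ ^ 2 = 0 := le_antisymm (by linarith) (sq_nonneg _)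
    simpa [sub_eq_zero] using h2
  subst haeq
  exact ⟨fun j => ψ j + 1, x ∘ ψ, y ∘ ψ, z ∘ ψ, fun j => hpos _, hxa, hya, hza, fun j => h (ψ j)⟩

/-- Sequential necessary optimality conditions for a local minimizer, with the multiplier
`c j • (y j - ybar)` and the rate at which feasibility is recovered. -/
theorem exists_approximately_stationary_sequence [FiniteDimensional ℝ X] [FiniteDimensional ℝ Y]
    {φ : X → ℝ} (hφ : LocallyLipschitz φ) {Φ : X → Set Y} (hΦ : IsClosed (graph Φ))
    {ybar : Y} {xbar : X} (hfeas : xbar ∈ feasibleSet Φ ybar)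
    (hmin : IsLocalMinOn φ (feasibleSet Φ ybar) xbar) :
    ∃ (K : ℝ) (c : ℕ → ℝ) (x : ℕ → X) (y : ℕ → Y) (z : ℕ → X), 0 ≤ K ∧
      Tendsto x atTop (𝓝 xbar) ∧ Tendsto y atTop (𝓝 ybar) ∧ Tendsto z atTop (𝓝 xbar) ∧
      ∀ j, 0 < c j ∧ y j ∈ Φ (x j) ∧ c j * ‖x j - z j‖ ≤ 2 * K ∧
        c j * ‖y j - ybar‖ ^ 2 ≤ 2 * K * ‖z j - xbar‖ ∧
        φ (x j) - φ xbar ≤ K * ‖x j - z j‖ ∧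
        WithLp.toLp 2 (-(c j • (x j - z j)) - (x j - xbar), -(c j • (y j - ybar))) ∈
          regularNormalCone (graph Φ) (WithLp.toLp 2 (x j, y j)) ∧
        WithLp.toLp 2 (c j • (x j - z j), (-1 : ℝ)) ∈
          regularNormalCone (epigraph φ) (WithLp.toLp 2 (z j, φ (z j))) := by
  obtain ⟨K, s, hs, hK⟩ := hφ xbar
  have hmin' : ∀ᶠ a in 𝓝 xbar, a ∈ feasibleSet Φ ybar → φ xbar ≤ φ a :=
    eventually_nhdsWithin_iff.1 hmin
  obtain ⟨ε, hε, hball⟩ := Metric.nhds_basis_closedBall.mem_iff.1 (inter_mem hs hmin')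
  have hK' : ∀ a ∈ Metric.closedBall xbar ε, ∀ b ∈ Metric.closedBall xbar ε,
      φ a - φ b ≤ K * ‖a - b‖ := fun a ha b hb => by
    have := hK.dist_le_mul a (hball ha).1 b (hball hb).1
    rw [Real.dist_eq, dist_eq_norm] at this
    exact (le_abs_self _).trans this
  obtain ⟨c, x, y, z, hc, hx, hy, hz, h⟩ := exists_tendsto_isPenaltyMinimizer hφ.continuous hΦ
    hfeas hε.le K.2 hK' fun a ha hfa => (hball ha).2 hfa
  obtain ⟨N, hN⟩ := eventually_atTop.1 ((hx.eventually_mem (Metric.ball_mem_nhds xbar hε)).and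
    ((hy.eventually_mem (Metric.ball_mem_nhds ybar one_pos)).and
      (hz.eventually_mem (Metric.ball_mem_nhds xbar hε))))
  -- Past `N` the iterates lie in the open balls, so the localization is inactive.
  have hshift : Tendsto (fun j => j + N) atTop atTop := tendsto_add_atTop_nat N
  refine ⟨K, fun j => c (j + N), fun j => x (j + N), fun j => y (j + N), fun j => z (j + N), K.2,
    hx.comp hshift, hy.comp hshift, hz.comp hshift, fun j => ?_⟩
  obtain ⟨hxj, hyj, hzj⟩ := hN (j + N) (Nat.le_add_left _ _)
  have hj := h (j + N)
  have hcj := hc (j + N)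
  have hv := hj.value_le hcj.le hε.le hfeas
  have hz' := hK' xbar (by simp [hε.le]) _ hj.right_mem
  rw [norm_sub_rev] at hz'
  have hx' := hK' _ hj.left_mem _ hj.right_mem
  have p1 := sq_nonneg ‖x (j + N) - xbar‖
  have p2 := mul_nonneg hcj.le (sq_nonneg ‖y (j + N) - ybar‖)
  exact ⟨hcj, hj.mem, hj.mul_norm_sub_le hK' K.2, by linarith, by linarith,
    hj.mem_regularNormalCone_graph hcj.le hxj hyj, hj.mem_regularNormalCone_epigraph hcj.le hzj⟩

/-! ### Bounded versus unbounded multipliers. -/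

theorem IsCriticalDirection.zero_mem_graphicalDerivative {φ : X → ℝ} {Φ : X → Set Y} {ybar : Y}
    {xbar u : X} (h : IsCriticalDirection φ Φ ybar xbar u) (hfeas : xbar ∈ feasibleSet Φ ybar) :
    (0 : Y) ∈ graphicalDerivative Φ xbar ybar u := by
  obtain ⟨-, uk, vk, t, hu, hv, ht, ht0, hg, -⟩ := h
  exact ⟨hfeas, fun k => WithLp.toLp 2 (uk k, vk k), t,
    ((WithLp.prod_continuous_toLp 2 X Y).tendsto (u, 0)).comp (hu.prodMk_nhds hv), ht, ht0, hg⟩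

theorem isMStationary_or_exists_criticalDirection [FiniteDimensional ℝ X] [FiniteDimensional ℝ Y]
    {φ : X → ℝ} (hφ : LocallyLipschitz φ) {Φ : X → Set Y} (hΦ : IsClosed (graph Φ))
    {ybar : Y} {xbar : X} (hfeas : xbar ∈ feasibleSet Φ ybar)
    (hmin : IsLocalMinOn φ (feasibleSet Φ ybar) xbar) :
    IsMStationary φ Φ ybar xbar ∨ ∃ u : X, IsCriticalDirection φ Φ ybar xbar u ∧
      ∃ lam : Y, lam ≠ 0 ∧ (0 : X) ∈ dirLimitingCoderivative Φ xbar ybar u 0 lam := by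
  have := FiniteDimensional.proper_real X
  have := FiniteDimensional.proper_real Y
  obtain ⟨K, c, x, y, z, hK, hx, hy, hz, h⟩ :=
    exists_approximately_stationary_sequence hφ hΦ hfeas hmin
  choose hc hmem hη hyz hφx hgr hepi using h
  have hcontXY := WithLp.prod_continuous_toLp 2 X Y
  have hcontXR := WithLp.prod_continuous_toLp 2 X ℝ
  have hηnorm : ∀ j, ‖c j • (x j - z j)‖ ≤ 2 * K := fun j => by
    rw [norm_smul, Real.norm_of_nonneg (hc j).le]; exact hη j
  by_cases hbdd : ∃ R : ℝ, ∃ᶠ j in atTop, ‖c j • (y j - ybar)‖ ≤ R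
  · left
    obtain ⟨R, hR⟩ := hbdd
    obtain ⟨⟨η, lam⟩, -, ψ, hψ, hlim⟩ :=
      ((isCompact_closedBall (0 : X) (2 * K)).prod
        (isCompact_closedBall (0 : Y) R)).tendsto_subseq'
        (x := fun j => (c j • (x j - z j), c j • (y j - ybar)))
        (hR.mono fun j hj => ⟨by simpa using hηnorm j, by simpa using hj⟩)
    have hlimη : Tendsto (fun j => c (ψ j) • (x (ψ j) - z (ψ j))) atTop (𝓝 η) :=
      (continuous_fst.tendsto _).comp hlim
    have hlimlam : Tendsto (fun j => c (ψ j) • (y (ψ j) - ybar)) atTop (𝓝 lam) :=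
      (continuous_snd.tendsto _).comp hlim
    have hxψ := hx.comp hψ.tendsto_atTop
    have hyψ := hy.comp hψ.tendsto_atTop
    have hzψ := hz.comp hψ.tendsto_atTop
    refine ⟨hfeas, lam, Set.mem_add.2 ⟨η, ?_, -η, ?_, add_neg_cancel η⟩⟩
    · refine ⟨le_refl (φ xbar), _, _, (hcontXR.tendsto _).comp
        (hzψ.prodMk_nhds ((hφ.continuous.tendsto xbar).comp hzψ)),
        (hcontXR.tendsto _).comp (hlimη.prodMk_nhds tendsto_const_nhds), fun j => hepi (ψ j)⟩
    · refine ⟨hfeas, _, _, (hcontXY.tendsto _).comp (hxψ.prodMk_nhds hyψ),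
        (hcontXY.tendsto _).comp (Tendsto.prodMk_nhds ?_ hlimlam.neg), fun j => hgr (ψ j)⟩
      simpa using hlimη.neg.sub (hxψ.sub_const xbar)
  · right
    push Not at hbdd
    have hΛ : Tendsto (fun j => ‖c j • (y j - ybar)‖) atTop atTop :=
      tendsto_atTop.2 fun R => (hbdd R).mono fun j hj => hj.le
    -- The threshold beats twice the constant in `hLxz`, which lets `‖x j - z j‖` be absorbed in
    -- `hzx`; it also gives `1 ≤ L`.
    obtain ⟨N, hN⟩ := eventually_atTop.1 (hΛ.eventually_ge_atTop (8 * K ^ 2 + 1))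
    have hest : ∀ j, N ≤ j → 0 < ‖x j - xbar‖ ∧ 0 < ‖c j • (y j - ybar)‖ ∧
        ‖c j • (y j - ybar)‖ * ‖y j - ybar‖ ≤ 4 * K * ‖x j - xbar‖ ∧
        ‖c j • (y j - ybar)‖ * ‖x j - z j‖ ≤ 8 * K ^ 2 * ‖x j - xbar‖ := by
      intro j hj
      have hL := hN j hj
      have hLdef : ‖c j • (y j - ybar)‖ = c j * ‖y j - ybar‖ := by
        rw [norm_smul, Real.norm_of_nonneg (hc j).le]
      set L := ‖c j • (y j - ybar)‖
      have hL1 : 1 ≤ L := le_trans (by nlinarith [sq_nonneg K]) hL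
      have hLy : L * ‖y j - ybar‖ ≤ 2 * K * ‖z j - xbar‖ := by
        have := hyz j
        rw [hLdef]; linarith
      have hLxz : L * ‖x j - z j‖ ≤ 4 * K ^ 2 * ‖z j - xbar‖ := by
        have h1 : L ^ 2 ≤ 2 * K * ‖z j - xbar‖ * c j := by
          calc L ^ 2 = (L * ‖y j - ybar‖) * c j := by rw [hLdef]; ring
            _ ≤ _ := mul_le_mul_of_nonneg_right hLy (hc j).le
        -- Squaring `L` produces a factor `c j`, which pairs with `‖x j - z j‖` in `hη`.
        calc L * ‖x j - z j‖ ≤ L ^ 2 * ‖x j - z j‖ := by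
              gcongr; nlinarith
          _ ≤ (2 * K * ‖z j - xbar‖ * c j) * ‖x j - z j‖ := by gcongr
          _ = 2 * K * ‖z j - xbar‖ * (c j * ‖x j - z j‖) := by ring
          _ ≤ 2 * K * ‖z j - xbar‖ * (2 * K) :=
              mul_le_mul_of_nonneg_left (hη j) (by positivity)
          _ = _ := by ring
      have htri : ‖z j - xbar‖ ≤ ‖x j - z j‖ + ‖x j - xbar‖ := by
        rw [norm_sub_rev (x j) (z j)]
        exact norm_sub_le_norm_sub_add_norm_sub _ _ _
      have hzx : ‖z j - xbar‖ ≤ 2 * ‖x j - xbar‖ := by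
        have h1 : (8 * K ^ 2 + 1) * ‖x j - z j‖ ≤ L * ‖x j - z j‖ := by gcongr
        have h2 : 8 * K ^ 2 * ‖z j - xbar‖ ≤ 8 * K ^ 2 * (‖x j - z j‖ + ‖x j - xbar‖) := by
          gcongr
        by_contra hcon
        push Not at hcon
        have h3 : ‖z j - xbar‖ < 2 * ‖x j - z j‖ := by linarith
        have h4 : 4 * K ^ 2 * ‖z j - xbar‖ ≤ 4 * K ^ 2 * (2 * ‖x j - z j‖) := by gcongr
        nlinarith [norm_nonneg (z j - xbar)]
      refine ⟨?_, by linarith, ?_, ?_⟩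
      -- If `x j = xbar`, then `hzx` and `hLy` give `z j = xbar` and `y j = ybar`, so `L = 0`.
      · by_contra hcon
        have h1 : ‖z j - xbar‖ = 0 := le_antisymm (by linarith) (norm_nonneg _)
        rw [h1, mul_zero] at hLy
        have h2 : ‖y j - ybar‖ ≤ 0 := by nlinarith [norm_nonneg (y j - ybar)]
        have h3 : ‖y j - ybar‖ = 0 := le_antisymm h2 (norm_nonneg _)
        rw [h3, mul_zero] at hLdef
        linarith
      · nlinarith
      · nlinarith [mul_le_mul_of_nonneg_left hzx (sq_nonneg K)]
    let uv : ℕ → X × Y := fun j => (‖x (j + N) - xbar‖⁻¹ • (x (j + N) - xbar),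
      ‖c (j + N) • (y (j + N) - ybar)‖⁻¹ • (c (j + N) • (y (j + N) - ybar)))
    obtain ⟨⟨u, lam⟩, ⟨hu, hlam⟩, ψ, hψ, hlim⟩ :=
      ((isCompact_sphere (0 : X) 1).prod (isCompact_sphere (0 : Y) 1)).tendsto_subseq
        (x := uv) fun j => by
          obtain ⟨h1, h2, -, -⟩ := hest (j + N) (Nat.le_add_left _ _)
          refine ⟨?_, ?_⟩
          · rw [mem_sphere_zero_iff_norm, norm_smul, norm_inv, norm_norm, inv_mul_cancel₀ h1.ne']
          · rw [mem_sphere_zero_iff_norm, norm_smul, norm_inv, norm_norm, inv_mul_cancel₀ h2.ne']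
    obtain ⟨θ, hθdef⟩ : ∃ θ : ℕ → ℕ, θ = fun j => ψ j + N := ⟨_, rfl⟩
    have hθ : Tendsto θ atTop atTop := by
      rw [hθdef]; exact (tendsto_add_atTop_nat N).comp hψ.tendsto_atTop
    have hθN : ∀ j, N ≤ θ j := fun j => by rw [hθdef]; exact Nat.le_add_left _ _
    have hlimu : Tendsto (fun j => ‖x (θ j) - xbar‖⁻¹ • (x (θ j) - xbar)) atTop (𝓝 u) := by
      rw [hθdef]; exact (continuous_fst.tendsto _).comp hlim
    have hlimlam : Tendsto (fun j => ‖c (θ j) • (y (θ j) - ybar)‖⁻¹ •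
        (c (θ j) • (y (θ j) - ybar))) atTop (𝓝 lam) := by
      rw [hθdef]; exact (continuous_snd.tendsto _).comp hlim
    have hxθ := hx.comp hθ
    have hinv : Tendsto (fun j => ‖c (θ j) • (y (θ j) - ybar)‖⁻¹) atTop (𝓝 0) :=
      (hΛ.comp hθ).inv_tendsto_atTop
    have ht : ∀ j, 0 < ‖x (θ j) - xbar‖ := fun j => (hest _ (hθN j)).1
    have ht0 : Tendsto (fun j => ‖x (θ j) - xbar‖) atTop (𝓝 0) := by
      simpa using (hxθ.sub_const xbar).norm
    have hlimv : Tendsto (fun j => ‖x (θ j) - xbar‖⁻¹ • (y (θ j) - ybar)) atTop (𝓝 0) := by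
      refine squeeze_zero_norm (a := fun j => 4 * K * ‖c (θ j) • (y (θ j) - ybar)‖⁻¹)
        (fun j => ?_) (by simpa using hinv.const_mul (4 * K))
      obtain ⟨h1, h2, h3, -⟩ := hest _ (hθN j)
      rw [norm_smul, norm_inv, norm_norm, inv_mul_le_iff₀ h1, ← div_eq_mul_inv, mul_div_assoc',
        le_div_iff₀ h2]
      linarith
    have hxeq : ∀ j, xbar + ‖x (θ j) - xbar‖ • ‖x (θ j) - xbar‖⁻¹ • (x (θ j) - xbar) = x (θ j) :=
      fun j => by rw [smul_inv_smul₀ (ht j).ne', add_sub_cancel]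
    have hyeq : ∀ j, ybar + ‖x (θ j) - xbar‖ • ‖x (θ j) - xbar‖⁻¹ • (y (θ j) - ybar) = y (θ j) :=
      fun j => by rw [smul_inv_smul₀ (ht j).ne', add_sub_cancel]
    refine ⟨u, ⟨hu, _, _, _, hlimu, hlimv, ht, ht0, fun j => ?_, ?_⟩, lam, ?_, ?_⟩
    · rw [hxeq, hyeq]
      exact hmem _
    · have hbound : Tendsto (fun j => K * (8 * K ^ 2 * ‖c (θ j) • (y (θ j) - ybar)‖⁻¹)) atTop
          (𝓝 0) := by simpa using (hinv.const_mul (8 * K ^ 2)).const_mul K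
      have hE : Tendsto (fun j =>
          ((K * (8 * K ^ 2 * ‖c (θ j) • (y (θ j) - ybar)‖⁻¹) : ℝ) : EReal)) atTop (𝓝 0) :=
        (continuous_coe_real_ereal.tendsto 0).comp hbound
      -- The difference quotients are dominated by a null sequence of order `1 / ‖λ‖`.
      rw [← hE.limsup_eq]
      refine limsup_le_limsup (Eventually.of_forall fun j => ?_)
      obtain ⟨h1, h2, -, h4⟩ := hest _ (hθN j)
      beta_reduce
      rw [hxeq, EReal.coe_le_coe_iff, div_le_iff₀ h1]
      refine (hφx (θ j)).trans ?_
      rw [mul_assoc]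
      refine mul_le_mul_of_nonneg_left ?_ hK
      rw [← div_eq_mul_inv, div_mul_eq_mul_div, le_div_iff₀ h2]
      linarith
    · rintro rfl
      simp at hlam
    · refine ⟨hfeas, fun j => WithLp.toLp 2 (‖x (θ j) - xbar‖⁻¹ • (x (θ j) - xbar),
        ‖x (θ j) - xbar‖⁻¹ • (y (θ j) - ybar)), fun j => ‖x (θ j) - xbar‖,
        fun j => ‖c (θ j) • (y (θ j) - ybar)‖⁻¹ • WithLp.toLp 2
          (-(c (θ j) • (x (θ j) - z (θ j))) - (x (θ j) - xbar), -(c (θ j) • (y (θ j) - ybar))),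
        (hcontXY.tendsto _).comp (hlimu.prodMk_nhds hlimv), ht, ht0, ?_, fun j => ?_⟩
      · simp only [← WithLp.toLp_smul, Prod.smul_mk]
        refine (hcontXY.tendsto _).comp (Tendsto.prodMk_nhds ?_ ?_)
        -- The subgradient part is bounded, so scaling by `1 / ‖λ‖` removes `φ` from the limit
        -- normal.
        · have hbddX : Tendsto (fun j => ‖c (θ j) • (y (θ j) - ybar)‖⁻¹ •
              (c (θ j) • (x (θ j) - z (θ j)))) atTop (𝓝 0) := by
            refine squeeze_zero_norm (a := fun j => ‖c (θ j) • (y (θ j) - ybar)‖⁻¹ * (2 * K))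
              (fun j => ?_) (by simpa using hinv.mul_const (2 * K))
            rw [norm_smul, norm_inv, norm_norm]
            gcongr
            exact hηnorm _
          have hres := hinv.smul (hxθ.sub_const xbar)
          simpa [smul_sub, smul_neg, Function.comp_def] using hbddX.neg.sub hres
        · simpa only [smul_neg] using hlimlam.neg
      · have hpt : WithLp.toLp 2 (xbar, ybar) + ‖x (θ j) - xbar‖ • WithLp.toLp 2
            (‖x (θ j) - xbar‖⁻¹ • (x (θ j) - xbar), ‖x (θ j) - xbar‖⁻¹ • (y (θ j) - ybar)) =
            WithLp.toLp 2 (x (θ j), y (θ j)) := by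
          rw [← WithLp.toLp_smul, ← WithLp.toLp_add, Prod.smul_mk, Prod.mk_add_mk, hxeq, hyeq]
        rw [hpt]
        exact smul_mem_regularNormalCone (hgr _) (inv_pos.2 (hest _ (hθN j)).2.1)

end VarAnal

theorem corollary4p6
    {X Y : Type*}
    [NormedAddCommGroup X] [InnerProductSpace ℝ X] [FiniteDimensional ℝ X]
    [NormedAddCommGroup Y] [InnerProductSpace ℝ Y] [FiniteDimensional ℝ Y]
    (φ : X → ℝ) (hφ : LocallyLipschitz φ)
    (Φ : X → Set Y) (hΦ : IsClosed (VarAnal.graph Φ))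
    (ybar : Y) (xbar : X)
    (hfeas : xbar ∈ VarAnal.feasibleSet Φ ybar)
    (hmin : IsLocalMinOn φ (VarAnal.feasibleSet Φ ybar) xbar) :
    (VarAnal.IsMStationary φ Φ ybar xbar ∨
      ∃ u : X, VarAnal.IsCriticalDirection φ Φ ybar xbar u ∧
        ∃ lam : Y, lam ≠ 0 ∧
          (0 : X) ∈ VarAnal.dirLimitingCoderivative Φ xbar ybar u 0 lam) ∧
    (VarAnal.FOSCMS Φ xbar ybar → VarAnal.IsMStationary φ Φ ybar xbar) := by
  have hmain := VarAnal.isMStationary_or_exists_criticalDirection hφ hΦ hfeas hmin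
  refine ⟨hmain, fun hfos => hmain.resolve_right ?_⟩
  rintro ⟨u, hu, lam, hlam, hzero⟩
  have hker := hfos u ⟨hu.zero_mem_graphicalDerivative hfeas, hu.1⟩
  have hmem : lam ∈ VarAnal.setKer (VarAnal.dirLimitingCoderivative Φ xbar ybar u 0) := hzero
  rw [hker] at hmem
  exact hlam hmem
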